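/- **Conventions.** A *colour* is a finite set $I$ of integers $\ge 1$; the empty colour indexes objects. For $j\in I$ write $I-j=I\setminus\{j\}$, and for $r\notin I$ write $I+r=I\cup\{r\}$. A *multiple set* $(C,s,t)$ consists of sets $C_I$ (one for each colour $I$) and maps $s_j,t_j:C_I\to C_{I-j}$ for $j\in I$ such that, for $j\ne k$ in $I$, $s_ks_j=s_js_k$, $t_kt_j=t_jt_k$, $t_ks_j=s_jt_k$. Morphisms are families of maps commuting with all $s_j,t_j$. The category is $\mathbb{M}\mathrm{Sets}$. A *reflexive multiple $\infty$-magma* is a multiple set with * reflexions $1_j:C_{I-j}\to C_I$ ($j\in I$) with $s_j1_j=t_j1_j=\mathrm{id}$ and, for $j\neq k$, $s_k1_j=1_js_k$, $t_k1_j=1_jt_k$, $1_j1_k=1_k1_j$; * compositions $a\circ_j b\in C_I$, for $j\in I$ and $a,b\in C_I$ with $s_j(a)=t_j(b)$, with $s_j(a\circ_jb)=s_j(b)$, $t_j(a\circ_jb)=t_j(a)$ and, for $k\ne j$, $s_k(a\circ_jb)=s_k(a)\circ_js_k(b)$, $t_k(a\circ_jb)=t_k(a)\circ_jt_k(b)$,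 $1_k(a\circ_jb)=1_k(a)\circ_j1_k(b)$. It is a *strict multiple $\infty$-category* if moreover each $\circ_j$ is associative, $a\circ_j1_j(s_ja)=a=1_j(t_ja)\circ_ja$, and $(a\circ_jb)\circ_k(c\circ_jd)=(a\circ_kc)\circ_j(b\circ_kd)$ for $j\neq k$ whenever these composites are defined. Let $m\ge 0$. An *$(\infty,m)$-structure* on a multiple set is a family of maps (reversors) $\mathrm{rev}_j:C_I\to C_I$, for all $I$ with $|I|>m$ and all $j\in I$, with $s_j\,\mathrm{rev}_j=t_j$ and $t_j\,\mathrm{rev}_j=s_j$. A *reflexive multiple $(\infty,m)$-magma* (respectively a *strict multiple $(\infty,m)$-category*) is a reflexive multiple $\infty$-magma (respectively a strict multiple $\infty$-category) equipped with an $(\infty,m)$-structure. In both cases morphisms are the morphisms of multiple sets preserving reflexions, compositions and reversors. A *multiple $(\infty,m)$-categorical stretching* consists of a reflexive multiple $(\infty,m)$-magma $M$, a strict multiple $(\infty,m)$-category $C$, a morphism $\pi:M\to C$ of reflexive multiple $(\infty,m)$-magmas, and, for every colour $I$ and every $r\notin I$, an operation assigning to each pair $\alpha,\beta\in M_I$ with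 $\pi(\alpha)=\pi(\beta)$ an element $[\alpha;\beta]_r\in M_{I+r}$ such that $$s_k[\alpha;\beta]_r=[s_k\alpha;s_k\beta]_r,\quad t_k[\alpha;\beta]_r=[t_k\alpha;t_k\beta]_r\ \ (k\in I),$$ $$s_r[\alpha;\beta]_r=\alpha,\quad t_r[\alpha;\beta]_r=\beta,\quad \pi([\alpha;\beta]_r)=1_r(\pi(\alpha))=1_r(\pi(\beta)).$$ A morphism $(M,C,\pi,[-;-])\to(M',C',\pi',[-;-]')$ is a pair of morphisms $f:M\to M'$, $c:C\to C'$ of reflexive multiple $(\infty,m)$-magmas with $\pi' f=c\pi$ and $f([\alpha;\beta]_r)=[f\alpha;f\beta]'_r$. The resulting category is $(\infty,m)\text{-}\mathbb{M}\mathrm{EtC}$, and $U^m:(\infty,m)\text{-}\mathbb{M}\mathrm{EtC}\to\mathbb{M}\mathrm{Sets}$ is the forgetful functor sending a stretching to the multiple set underlying $M$. **Proposition.** For every $m\ge0$: 1. The functor $U^m$ has a left adjoint, and the adjunction induces a monad $\mathbb{M}^m=(M^m,\eta^m,\nu^m)$ on $\mathbb{M}\mathrm{Sets}$. 2. The same holds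 for the restriction of $U^m$ to the full subcategory of those stretchings for which the reversors of $C$ are inverses, i.e. $a\circ_j\mathrm{rev}_j(a)=1_j(t_ja)$ and $\mathrm{rev}_j(a)\circ_ja=1_j(s_ja)$ for all $a\in C_I$, $|I|>m$, $j\in I$. (By definition, *weak multiple $(\infty,m)$-categories* are the algebras of $\mathbb{M}^m$, and *weak multiple $\infty$-groupoids* are the case $m=0$.) -/

import Mathlib

open CategoryTheory

universe u

/-- A colour is a finite set of `1`-colours; a finite set of cardinality `n` is the same thing as an
`n`-colour `i₁ < i₂ < ... < iₙ` with `1 ≤ i₁`.  The empty colour indexes the set of objects. -/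
abbrev Color := Finset ℕ+

/-- `Step j K I` says that `j ∈ I` and `K = I - j`; equivalently `j ∉ K` and `I = K + j`. -/
structure Step (j : ℕ+) (K I : Color) : Prop where
  notMem : j ∉ K
  insert_eq : insert j K = I

/-- For a colour `I` and two distinct `1`-colours `j, k ∈ I`, the square of colours with
`A = I - j`, `A' = I - k`, `B = I - j - k`. -/
structure ColorSquare (j k : ℕ+) (B A A' I : Color) : Prop where
  hj : Step j A I
  hk : Step k A' I
  hk' : Step k B A
  hj' : Step j B A'

theorem step_iff {j : ℕ+} {K I : Color} : Step j K I ↔ j ∈ I ∧ K = I.erase j := by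
  constructor
  · rintro ⟨h, rfl⟩
    exact ⟨Finset.mem_insert_self _ _, (Finset.erase_insert h).symm⟩
  · rintro ⟨h, rfl⟩
    exact ⟨Finset.notMem_erase _ _, Finset.insert_erase h⟩

theorem colorSquare_iff {j k : ℕ+} {B A A' I : Color} : ColorSquare j k B A A' I ↔
    j ∈ I ∧ k ∈ I ∧ j ≠ k ∧ A = I.erase j ∧ A' = I.erase k ∧ B = (I.erase j).erase k := by
  constructor
  · rintro ⟨h1, h2, h3, -⟩
    rw [step_iff] at h1 h2 h3
    obtain ⟨a, rfl⟩ := h1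
    obtain ⟨b, rfl⟩ := h2
    obtain ⟨c, rfl⟩ := h3
    exact ⟨a, b, (Finset.ne_of_mem_erase c).symm, rfl, rfl, rfl⟩
  · rintro ⟨a, b, c, rfl, rfl, rfl⟩
    refine ⟨step_iff.2 ⟨a, rfl⟩, step_iff.2 ⟨b, rfl⟩, step_iff.2 ⟨?_, rfl⟩, step_iff.2 ⟨?_, ?_⟩⟩
    · exact Finset.mem_erase.2 ⟨c.symm, b⟩
    · exact Finset.mem_erase.2 ⟨c, a⟩
    · exact Finset.erase_right_comm

/-! ### Multiple sets -/

/-- Multiple sets `(C, s, t)`. -/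
structure MSet where
  /-- the set of cells of colour `I` -/
  X : Color → Type u
  /-- the source along `j` -/
  s {j : ℕ+} {K I : Color} (h : Step j K I) : X I → X K
  /-- the target along `j` -/
  t {j : ℕ+} {K I : Color} (h : Step j K I) : X I → X K
  s_s {j k : ℕ+} {B A A' I : Color} (q : ColorSquare j k B A A' I) (x : X I) :
    s q.hk' (s q.hj x) = s q.hj' (s q.hk x)
  t_t {j k : ℕ+} {B A A' I : Color} (q : ColorSquare j k B A A' I) (x : X I) :
    t q.hk' (t q.hj x) = t q.hj' (t q.hk x)
  t_s {j k : ℕ+} {B A A' I : Color} (q : ColorSquare j k B A A' I) (x : X I) :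
    t q.hk' (s q.hj x) = s q.hj' (t q.hk x)

namespace MSet

/-- Morphisms of multiple sets. -/
@[ext]
structure Hom (C D : MSet.{u}) where
  map (I : Color) : C.X I → D.X I
  map_s {j : ℕ+} {K I : Color} (h : Step j K I) (x : C.X I) : map K (C.s h x) = D.s h (map I x)
  map_t {j : ℕ+} {K I : Color} (h : Step j K I) (x : C.X I) : map K (C.t h x) = D.t h (map I x)

/-- The identity morphism. -/
def Hom.id (C : MSet.{u}) : Hom C C := ⟨fun _ x => x, fun _ _ => rfl, fun _ _ => rfl⟩

/-- The composite of `f` followed by `g`. -/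
def Hom.comp {C D E : MSet.{u}} (f : Hom C D) (g : Hom D E) : Hom C E where
  map I x := g.map I (f.map I x)
  map_s h x := by rw [f.map_s, g.map_s]
  map_t h x := by rw [f.map_t, g.map_t]

/-- The category of multiple sets. -/
instance : Category MSet.{u} where
  Hom := Hom
  id := Hom.id
  comp := Hom.comp

end MSet

/-! ### Reflexive multiple magmas -/

/-- Reflexive multiple sets `(C, s, t, 1)`. -/
structure ReflMSet extends MSet.{u} where
  /-- the reflexion `C_{I - j} → C_I` -/
  one {j : ℕ+} {K I : Color} (h : Step j K I) : X K → X I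
  s_one_self {j : ℕ+} {K I : Color} (h : Step j K I) (x : X K) : s h (one h x) = x
  t_one_self {j : ℕ+} {K I : Color} (h : Step j K I) (x : X K) : t h (one h x) = x
  s_one {j k : ℕ+} {B A A' I : Color} (q : ColorSquare j k B A A' I) (x : X A) :
    s q.hk (one q.hj x) = one q.hj' (s q.hk' x)
  t_one {j k : ℕ+} {B A A' I : Color} (q : ColorSquare j k B A A' I) (x : X A) :
    t q.hk (one q.hj x) = one q.hj' (t q.hk' x)
  one_one {j k : ℕ+} {B A A' I : Color} (q : ColorSquare j k B A A' I) (x : X B) :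
    one q.hj (one q.hk' x) = one q.hk (one q.hj' x)

/-- Reflexive multiple `∞`-magmas: `comp h a b hab` is `a ∘ b` along the colour `j`, defined when the
source of `a` is the target of `b`. -/
structure ReflMagma extends ReflMSet.{u} where
  comp {j : ℕ+} {K I : Color} (h : Step j K I) (a b : X I) (hab : s h a = t h b) : X I
  s_comp_self {j : ℕ+} {K I : Color} (h : Step j K I) (a b : X I) (hab : s h a = t h b) :
    s h (comp h a b hab) = s h b
  t_comp_self {j : ℕ+} {K I : Color} (h : Step j K I) (a b : X I) (hab : s h a = t h b) :
    t h (comp h a b hab) = t h a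
  s_comp {j k : ℕ+} {B A A' I : Color} (q : ColorSquare j k B A A' I) (a b : X I)
    (hab : s q.hj a = t q.hj b) :
    s q.hk (comp q.hj a b hab) = comp q.hj' (s q.hk a) (s q.hk b)
      (by rw [← s_s q, hab, ← t_s ⟨q.hk, q.hj, q.hj', q.hk'⟩])
  t_comp {j k : ℕ+} {B A A' I : Color} (q : ColorSquare j k B A A' I) (a b : X I)
    (hab : s q.hj a = t q.hj b) :
    t q.hk (comp q.hj a b hab) = comp q.hj' (t q.hk a) (t q.hk b)
      (by rw [← t_s q, hab, ← t_t q])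
  one_comp {j k : ℕ+} {B A A' I : Color} (q : ColorSquare j k B A A' I) (a b : X A')
    (hab : s q.hj' a = t q.hj' b) :
    one q.hk (comp q.hj' a b hab) = comp q.hj (one q.hk a) (one q.hk b)
      (by rw [s_one ⟨q.hk, q.hj, q.hj', q.hk'⟩, hab, ← t_one ⟨q.hk, q.hj, q.hj', q.hk'⟩])

/-- Reflexive multiple `(∞,m)`-magmas: reflexive multiple `∞`-magmas with a reversor `j^I_j` for every
colour `I` with more than `m` elements and every `j ∈ I`. -/
structure ReflMagmaM (m : ℕ) extends ReflMagma.{u} where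
  rev {j : ℕ+} {K I : Color} (h : Step j K I) (hm : m < I.card) : X I → X I
  s_rev {j : ℕ+} {K I : Color} (h : Step j K I) (hm : m < I.card) (a : X I) :
    s h (rev h hm a) = t h a
  t_rev {j : ℕ+} {K I : Color} (h : Step j K I) (hm : m < I.card) (a : X I) :
    t h (rev h hm a) = s h a

/-- A reflexive multiple `∞`-magma is a strict multiple `∞`-category when its compositions are
associative, unital, and satisfy the middle-four interchange law. -/
structure ReflMagma.IsStrict (C : ReflMagma.{u}) : Prop where
  assoc {j : ℕ+} {K I : Color} (h : Step j K I) (a b c : C.X I) (hab : C.s h a = C.t h b)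
    (hbc : C.s h b = C.t h c) :
    C.comp h (C.comp h a b hab) c (by rw [C.s_comp_self, hbc]) =
      C.comp h a (C.comp h b c hbc) (by rw [C.t_comp_self, hab])
  comp_one {j : ℕ+} {K I : Color} (h : Step j K I) (a : C.X I) :
    C.comp h a (C.one h (C.s h a)) (by rw [C.t_one_self]) = a
  one_comp' {j : ℕ+} {K I : Color} (h : Step j K I) (a : C.X I) :
    C.comp h (C.one h (C.t h a)) a (by rw [C.s_one_self]) = a
  interchange {j k : ℕ+} {B A A' I : Color} (q : ColorSquare j k B A A' I) (a b c d : C.X I)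
    (hab : C.s q.hj a = C.t q.hj b) (hcd : C.s q.hj c = C.t q.hj d)
    (hac : C.s q.hk a = C.t q.hk c) (hbd : C.s q.hk b = C.t q.hk d) :
    C.comp q.hk (C.comp q.hj a b hab) (C.comp q.hj c d hcd)
        (by simp only [C.s_comp q, C.t_comp q, hac, hbd]) =
      C.comp q.hj (C.comp q.hk a c hac) (C.comp q.hk b d hbd)
        (by simp only [C.s_comp ⟨q.hk, q.hj, q.hj', q.hk'⟩, C.t_comp ⟨q.hk, q.hj, q.hj', q.hk'⟩, hab, hcd])

namespace ReflMagmaM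

variable {m : ℕ}

/-- Morphisms of reflexive multiple `(∞,m)`-magmas. -/
@[ext]
structure Hom (C D : ReflMagmaM.{u} m) extends MSet.Hom C.toMSet D.toMSet where
  map_one {j : ℕ+} {K I : Color} (h : Step j K I) (x : C.X K) :
    map I (C.one h x) = D.one h (map K x)
  map_comp {j : ℕ+} {K I : Color} (h : Step j K I) (a b : C.X I) (hab : C.s h a = C.t h b) :
    map I (C.comp h a b hab) =
      D.comp h (map I a) (map I b) (by rw [← map_s, hab, map_t])
  map_rev {j : ℕ+} {K I : Color} (h : Step j K I) (hm : m < I.card) (a : C.X I) :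
    map I (C.rev h hm a) = D.rev h hm (map I a)

/-- The identity morphism. -/
def Hom.id (C : ReflMagmaM.{u} m) : Hom C C :=
  ⟨MSet.Hom.id C.toMSet, fun _ _ => rfl, fun _ _ _ _ => rfl, fun _ _ _ => rfl⟩

/-- The composite of `f` followed by `g`. -/
def Hom.comp {C D E : ReflMagmaM.{u} m} (f : Hom C D) (g : Hom D E) : Hom C E where
  toHom := MSet.Hom.comp f.toHom g.toHom
  map_one h x := by simp only [MSet.Hom.comp, f.map_one, g.map_one]
  map_comp h a b hab := by simp only [MSet.Hom.comp, f.map_comp, g.map_comp]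
  map_rev h hm a := by simp only [MSet.Hom.comp, f.map_rev, g.map_rev]

/-- The category of reflexive multiple `(∞,m)`-magmas. -/
instance : Category (ReflMagmaM.{u} m) where
  Hom := Hom
  id := Hom.id
  comp := Hom.comp

end ReflMagmaM

/-- A strict multiple `(∞,m)`-category is a reflexive multiple `(∞,m)`-magma whose underlying
reflexive multiple `∞`-magma is a strict multiple `∞`-category.  Morphisms of strict multiple
`(∞,m)`-categories are those of the underlying reflexive multiple `(∞,m)`-magmas. -/
structure StrictMCat (m : ℕ) extends ReflMagmaM.{u} m where
  isStrict : toReflMagma.IsStrict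

/-- The reversors of a strict multiple `(∞,m)`-category are inverses for the compositions. -/
structure StrictMCat.HasInverses {m : ℕ} (C : StrictMCat.{u} m) : Prop where
  comp_rev {j : ℕ+} {K I : Color} (h : Step j K I) (hm : m < I.card) (a : C.X I) :
    C.comp h a (C.rev h hm a) (by rw [C.t_rev]) = C.one h (C.t h a)
  rev_comp {j : ℕ+} {K I : Color} (h : Step j K I) (hm : m < I.card) (a : C.X I) :
    C.comp h (C.rev h hm a) a (by rw [C.s_rev]) = C.one h (C.s h a)

/-! ### Multiple `(∞,m)`-categorical stretchings -/

/-- Multiple `(∞,m)`-categorical stretchings.  For `h : Step r K I`, i.e. `I = K + r`, and `α, β` of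
colour `K` with the same image under `π`, `bracket h α β e` is `[α; β]^K_{K + r}`. -/
structure Stretching (m : ℕ) where
  M : ReflMagmaM.{u} m
  C : StrictMCat.{u} m
  π : ReflMagmaM.Hom M C.toReflMagmaM
  bracket {r : ℕ+} {K I : Color} (h : Step r K I) (α β : M.X K) (e : π.map K α = π.map K β) : M.X I
  s_bracket {r k : ℕ+} {B A A' I : Color} (q : ColorSquare r k B A A' I) (α β : M.X A)
    (e : π.map A α = π.map A β) :
    M.s q.hk (bracket q.hj α β e) = bracket q.hj' (M.s q.hk' α) (M.s q.hk' β)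
      (by rw [π.map_s, e, π.map_s])
  t_bracket {r k : ℕ+} {B A A' I : Color} (q : ColorSquare r k B A A' I) (α β : M.X A)
    (e : π.map A α = π.map A β) :
    M.t q.hk (bracket q.hj α β e) = bracket q.hj' (M.t q.hk' α) (M.t q.hk' β)
      (by rw [π.map_t, e, π.map_t])
  s_bracket_self {r : ℕ+} {K I : Color} (h : Step r K I) (α β : M.X K)
    (e : π.map K α = π.map K β) : M.s h (bracket h α β e) = α
  t_bracket_self {r : ℕ+} {K I : Color} (h : Step r K I) (α β : M.X K)
    (e : π.map K α = π.map K β) : M.t h (bracket h α β e) = β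
  π_bracket {r : ℕ+} {K I : Color} (h : Step r K I) (α β : M.X K)
    (e : π.map K α = π.map K β) : π.map I (bracket h α β e) = C.one h (π.map K α)

namespace Stretching

variable {m : ℕ}

/-- Morphisms of multiple `(∞,m)`-categorical stretchings: commutative squares of morphisms of
reflexive multiple `(∞,m)`-magmas that preserve the brackets. -/
@[ext]
structure Hom (E E' : Stretching.{u} m) where
  f : ReflMagmaM.Hom E.M E'.M
  c : ReflMagmaM.Hom E.C.toReflMagmaM E'.C.toReflMagmaM
  w (I : Color) (x : E.M.X I) : E'.π.map I (f.map I x) = c.map I (E.π.map I x)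
  map_bracket {r : ℕ+} {K I : Color} (h : Step r K I) (α β : E.M.X K)
    (e : E.π.map K α = E.π.map K β) :
    f.map I (E.bracket h α β e) = E'.bracket h (f.map K α) (f.map K β) (by rw [w, e, w])

/-- The identity morphism. -/
def Hom.id (E : Stretching.{u} m) : Hom E E :=
  ⟨ReflMagmaM.Hom.id _, ReflMagmaM.Hom.id _, fun _ _ => rfl, fun _ _ _ _ => rfl⟩

/-- The composite of `a` followed by `b`. -/
def Hom.comp {E E' E'' : Stretching.{u} m} (a : Hom E E') (b : Hom E' E'') : Hom E E'' where
  f := ReflMagmaM.Hom.comp a.f b.f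
  c := ReflMagmaM.Hom.comp a.c b.c
  w I x := by simp only [ReflMagmaM.Hom.comp, MSet.Hom.comp, a.w, b.w]
  map_bracket h α β e := by
    simp only [ReflMagmaM.Hom.comp, MSet.Hom.comp, a.map_bracket, b.map_bracket]

/-- The category of multiple `(∞,m)`-categorical stretchings. -/
instance : Category (Stretching.{u} m) where
  Hom := Hom
  id := Hom.id
  comp := Hom.comp

/-- The forgetful functor `U^m`, sending a stretching to the multiple set underlying `M`. -/
def forget (m : ℕ) : Stretching.{u} m ⥤ MSet.{u} where
  obj E := E.M.toMSet
  map a := Hom.f a |>.toHom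

/-- Stretchings whose strict multiple `(∞,m)`-category `C` has its reversors as inverses. -/
def hasInverses (m : ℕ) : ObjectProperty (Stretching.{u} m) := fun E => E.C.HasInverses

/-- The restriction of `U^m` to the stretchings satisfying `hasInverses`. -/
abbrev forgetInv (m : ℕ) : (hasInverses.{u} m).FullSubcategory ⥤ MSet.{u} :=
  (hasInverses m).ι ⋙ forget m

end Stretching

/-- Weak multiple `(∞,m)`-categories are the algebras of the monad on multiple sets produced by a left
adjoint of the forgetful functor of stretchings; for `m = 0` they are weak multiple `∞`-groupoids. -/
abbrev WeakMultipleCat {m : ℕ} {F : MSet.{u} ⥤ Stretching.{u} m} (adj : F ⊣ Stretching.forget m) :=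
  adj.toMonad.Algebra

/-! Stretchings are the models of an essentially algebraic theory with two sorts of cells, those of
`M` and those of `C`: the operations are total except for composites and brackets, whose domains are
cut out by equations. The free stretching on `X` is therefore built syntactically. A model is a
stretching in the chosen class `P` with a map from `X`. Keep the raw terms all of whose subterms
make sense in every model, and identify those with equal values in every model. The models form a
large collection, but they enter only through propositions, so the cells stay in `Type u`.

By `Cell.ext` an equation between cells may be checked in each model, so all axioms are inherited
(`free`), as is the inverse law when `P` requires it (`hasInverses_free`). Evaluation in a model
gives the morphism extending a map out of `X` (`Model.desc`). It is unique because every cell comes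
from a term, and induction on terms shows that a morphism is determined on generators
(`Hom.ext_free`). -/

namespace Stretching

variable {m : ℕ}

/-! ### Terms and models. -/

/-- The two magmas of a stretching: `M` for `true` and `C` for `false`. -/
def magma (E : Stretching.{u} m) : Bool → ReflMagmaM.{u} m
  | true => E.M
  | false => E.C.toReflMagmaM

/-- Raw terms in the language of stretchings with variables in the cells of a multiple set. -/
inductive Term (m : ℕ) (X : MSet.{u}) : Bool → Color → Type u
  | var {I : Color} (x : X.X I) : Term m X true I
  | s {σ : Bool} {j : ℕ+} {K I : Color} (h : Step j K I) (a : Term m X σ I) : Term m X σ K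
  | t {σ : Bool} {j : ℕ+} {K I : Color} (h : Step j K I) (a : Term m X σ I) : Term m X σ K
  | one {σ : Bool} {j : ℕ+} {K I : Color} (h : Step j K I) (a : Term m X σ K) : Term m X σ I
  | comp {σ : Bool} {j : ℕ+} {K I : Color} (h : Step j K I) (a b : Term m X σ I) : Term m X σ I
  | rev {σ : Bool} {j : ℕ+} {K I : Color} (h : Step j K I) (hm : m < I.card)
      (a : Term m X σ I) : Term m X σ I
  | π {I : Color} (a : Term m X true I) : Term m X false I
  | bracket {r : ℕ+} {K I : Color} (h : Step r K I) (a b : Term m X true K) : Term m X true I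

/-- A stretching satisfying `P` under the multiple set `X`. -/
structure Model (P : ObjectProperty (Stretching.{u} m)) (X : MSet.{u}) where
  E : Stretching.{u} m
  prop : P E
  f : MSet.Hom X E.M.toMSet

variable {P : ObjectProperty (Stretching.{u} m)} {X : MSet.{u}}

open Classical in
/-- The value of a raw term in a model; undefined composites and brackets get an arbitrary value. -/
noncomputable def Model.eval (p : Model P X) :
    {σ : Bool} → {I : Color} → Term m X σ I → (p.E.magma σ).X I
  | _, _, .var x => p.f.map _ x
  | σ, _, .s h a => (p.E.magma σ).s h (p.eval a)
  | σ, _, .t h a => (p.E.magma σ).t h (p.eval a)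
  | σ, _, .one h a => (p.E.magma σ).one h (p.eval a)
  | σ, _, .comp h a b =>
      if e : (p.E.magma σ).s h (p.eval a) = (p.E.magma σ).t h (p.eval b) then
        (p.E.magma σ).comp h (p.eval a) (p.eval b) e
      else p.eval a
  | σ, _, .rev h hm a => (p.E.magma σ).rev h hm (p.eval a)
  | _, _, .π a => p.E.π.map _ (p.eval a)
  | _, _, .bracket (K := K) h a b =>
      if e : p.E.π.map K (p.eval a) = p.E.π.map K (p.eval b) then
        p.E.bracket h (p.eval a) (p.eval b) e
      -- The default must have colour `I`, which `p.eval a` has not; a bracket of a cell with itself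
      -- always exists.
      else p.E.bracket h (p.eval a) (p.eval a) rfl

/-- All composites and brackets in a raw term are defined in a model. -/
def Model.Defined (p : Model P X) : {σ : Bool} → {I : Color} → Term m X σ I → Prop
  | _, _, .var _ => True
  | _, _, .s _ a => p.Defined a
  | _, _, .t _ a => p.Defined a
  | _, _, .one _ a => p.Defined a
  | σ, _, .comp h a b => p.Defined a ∧ p.Defined b ∧
      (p.E.magma σ).s h (p.eval a) = (p.E.magma σ).t h (p.eval b)
  | _, _, .rev _ _ a => p.Defined a
  | _, _, .π a => p.Defined a
  | _, _, .bracket (K := K) _ a b => p.Defined a ∧ p.Defined b ∧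
      p.E.π.map K (p.eval a) = p.E.π.map K (p.eval b)

/-! ### Cells of the free stretching. -/

/-- Two terms defined in all models are identified when they have the same value in all models. -/
def cellSetoid (P : ObjectProperty (Stretching.{u} m)) (X : MSet.{u}) (σ : Bool) (I : Color) :
    Setoid {a : Term m X σ I // ∀ p : Model P X, p.Defined a} where
  r a b := ∀ p : Model P X, p.eval a.1 = p.eval b.1
  iseqv := ⟨fun _ _ => rfl, fun h p => (h p).symm, fun h h' p => (h p).trans (h' p)⟩

/-- The cells of the free stretching satisfying `P` on a multiple set. -/
def Cell (P : ObjectProperty (Stretching.{u} m)) (X : MSet.{u}) (σ : Bool) (I : Color) : Type u :=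
  Quotient (cellSetoid P X σ I)

namespace Cell

variable {σ : Bool} {I K : Color} {j : ℕ+}

/-- The cell represented by a term. -/
def mk (a : Term m X σ I) (ha : ∀ p : Model P X, p.Defined a) : Cell P X σ I :=
  Quotient.mk (cellSetoid P X σ I) ⟨a, ha⟩

/-- The value of a cell in a model. -/
noncomputable def eval (p : Model P X) (x : Cell P X σ I) : (p.E.magma σ).X I :=
  Quotient.lift (fun a => p.eval a.1) (fun a b h =>
    (show ∀ q : Model P X, q.eval a.1 = q.eval b.1 from h) p) x

/-- A term representing a cell. -/
noncomputable def term (x : Cell P X σ I) : Term m X σ I := (Quotient.out x).1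

theorem defined_term (x : Cell P X σ I) (p : Model P X) : p.Defined x.term :=
  (Quotient.out x).2 p

theorem eval_mk (p : Model P X) (a : Term m X σ I) (ha : ∀ p : Model P X, p.Defined a) :
    eval p (mk a ha) = p.eval a := rfl

/-- The operations below act on chosen representatives; this makes their values independent of the
choice. -/
theorem eval_term (p : Model P X) (x : Cell P X σ I) : p.eval x.term = eval p x := by
  conv_rhs => rw [← Quotient.out_eq x]
  rfl

theorem ext {x y : Cell P X σ I} (h : ∀ p : Model P X, eval p x = eval p y) : x = y := by
  induction x using Quotient.inductionOn
  induction y using Quotient.inductionOn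
  exact Quotient.sound h

theorem mk_term (x : Cell P X σ I) : mk x.term x.defined_term = x :=
  ext fun p => by rw [eval_mk, eval_term]

noncomputable def s (h : Step j K I) (x : Cell P X σ I) : Cell P X σ K :=
  mk (.s h x.term) fun p => x.defined_term p

noncomputable def t (h : Step j K I) (x : Cell P X σ I) : Cell P X σ K :=
  mk (.t h x.term) fun p => x.defined_term p

noncomputable def one (h : Step j K I) (x : Cell P X σ K) : Cell P X σ I :=
  mk (.one h x.term) fun p => x.defined_term p

noncomputable def rev (h : Step j K I) (hm : m < I.card) (x : Cell P X σ I) : Cell P X σ I :=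
  mk (.rev h hm x.term) fun p => x.defined_term p

noncomputable def π (x : Cell P X true I) : Cell P X false I :=
  mk (.π x.term) fun p => x.defined_term p

theorem eval_s (p : Model P X) (h : Step j K I) (x : Cell P X σ I) :
    eval p (x.s h) = (p.E.magma σ).s h (eval p x) := by
  rw [← eval_term p x]; rfl

theorem eval_t (p : Model P X) (h : Step j K I) (x : Cell P X σ I) :
    eval p (x.t h) = (p.E.magma σ).t h (eval p x) := by
  rw [← eval_term p x]; rfl

theorem eval_one (p : Model P X) (h : Step j K I) (x : Cell P X σ K) :
    eval p (x.one h) = (p.E.magma σ).one h (eval p x) := by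
  rw [← eval_term p x]; rfl

theorem eval_rev (p : Model P X) (h : Step j K I) (hm : m < I.card) (x : Cell P X σ I) :
    eval p (x.rev h hm) = (p.E.magma σ).rev h hm (eval p x) := by
  rw [← eval_term p x]; rfl

theorem eval_π (p : Model P X) (x : Cell P X true I) :
    eval p x.π = p.E.π.map I (eval p x) := by
  rw [← eval_term p x]; rfl

/-- Equal cells have equal values in every model. So the domain condition of a composite, known in
the quotient, holds in all models, which is what keeps the composite term everywhere defined. -/
theorem composable_eval {h : Step j K I} {x y : Cell P X σ I} (e : x.s h = y.t h)
    (p : Model P X) : (p.E.magma σ).s h (eval p x) = (p.E.magma σ).t h (eval p y) := by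
  rw [← eval_s, ← eval_t, e]

theorem parallel_eval {x y : Cell P X true K} (e : x.π = y.π) (p : Model P X) :
    p.E.π.map K (eval p x) = p.E.π.map K (eval p y) := by
  rw [← eval_π, ← eval_π, e]

noncomputable def comp (h : Step j K I) (x y : Cell P X σ I) (e : x.s h = y.t h) :
    Cell P X σ I :=
  mk (.comp h x.term y.term) fun p => ⟨x.defined_term p, y.defined_term p, by
    rw [eval_term, eval_term, composable_eval e]⟩

noncomputable def bracket (h : Step j K I) (x y : Cell P X true K) (e : x.π = y.π) :
    Cell P X true I :=
  mk (.bracket h x.term y.term) fun p => ⟨x.defined_term p, y.defined_term p, by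
    rw [eval_term, eval_term, parallel_eval e]⟩

theorem eval_comp (p : Model P X) (h : Step j K I) (x y : Cell P X σ I) (e : x.s h = y.t h) :
    eval p (x.comp h y e) =
      (p.E.magma σ).comp h (eval p x) (eval p y) (composable_eval e p) := by
  have := composable_eval e p
  rw [← eval_term p x, ← eval_term p y] at this
  refine (dif_pos this).trans ?_
  simp only [eval_term]

theorem eval_bracket (p : Model P X) (h : Step j K I) (x y : Cell P X true K) (e : x.π = y.π) :
    eval p (x.bracket h y e) =
      p.E.bracket h (eval p x) (eval p y) (parallel_eval e p) := by
  have := parallel_eval e p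
  rw [← eval_term p x, ← eval_term p y] at this
  refine (dif_pos this).trans ?_
  simp only [eval_term]
  rfl

end Cell

/-! ### The free stretching. -/

/-- The two reflexive multiple `(∞,m)`-magmas of the free stretching satisfying `P`. -/
noncomputable abbrev freeMagma (P : ObjectProperty (Stretching.{u} m)) (X : MSet.{u}) (σ : Bool) :
    ReflMagmaM.{u} m where
  X := Cell P X σ
  s := Cell.s
  t := Cell.t
  s_s q x := Cell.ext fun p => by simp only [Cell.eval_s]; exact (p.E.magma σ).s_s q _
  t_t q x := Cell.ext fun p => by simp only [Cell.eval_t]; exact (p.E.magma σ).t_t q _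
  t_s q x := Cell.ext fun p => by
    simp only [Cell.eval_s, Cell.eval_t]; exact (p.E.magma σ).t_s q _
  one := Cell.one
  s_one_self h x := Cell.ext fun p => by
    simp only [Cell.eval_s, Cell.eval_one]; exact (p.E.magma σ).s_one_self h _
  t_one_self h x := Cell.ext fun p => by
    simp only [Cell.eval_t, Cell.eval_one]; exact (p.E.magma σ).t_one_self h _
  s_one q x := Cell.ext fun p => by
    simp only [Cell.eval_s, Cell.eval_one]; exact (p.E.magma σ).s_one q _
  t_one q x := Cell.ext fun p => by
    simp only [Cell.eval_t, Cell.eval_one]; exact (p.E.magma σ).t_one q _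
  one_one q x := Cell.ext fun p => by
    simp only [Cell.eval_one]; exact (p.E.magma σ).one_one q _
  comp := Cell.comp
  s_comp_self h a b e := Cell.ext fun p => by
    simp only [Cell.eval_s, Cell.eval_comp]; exact (p.E.magma σ).s_comp_self h _ _ _
  t_comp_self h a b e := Cell.ext fun p => by
    simp only [Cell.eval_t, Cell.eval_comp]; exact (p.E.magma σ).t_comp_self h _ _ _
  s_comp q a b e := Cell.ext fun p => by
    simp only [Cell.eval_s, Cell.eval_comp]; exact (p.E.magma σ).s_comp q _ _ _
  t_comp q a b e := Cell.ext fun p => by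
    simp only [Cell.eval_t, Cell.eval_comp]; exact (p.E.magma σ).t_comp q _ _ _
  one_comp q a b e := Cell.ext fun p => by
    simp only [Cell.eval_one, Cell.eval_comp]; exact (p.E.magma σ).one_comp q _ _ _
  rev := Cell.rev
  s_rev h hm a := Cell.ext fun p => by
    simp only [Cell.eval_s, Cell.eval_t, Cell.eval_rev]; exact (p.E.magma σ).s_rev h hm _
  t_rev h hm a := Cell.ext fun p => by
    simp only [Cell.eval_s, Cell.eval_t, Cell.eval_rev]; exact (p.E.magma σ).t_rev h hm _

/-- The strict multiple `(∞,m)`-category of the free stretching satisfying `P`. -/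
noncomputable abbrev freeStrict (P : ObjectProperty (Stretching.{u} m)) (X : MSet.{u}) :
    StrictMCat.{u} m where
  toReflMagmaM := freeMagma P X false
  isStrict :=
    { assoc := fun h a b c hab hbc => Cell.ext fun p => by
        simp only [Cell.eval_comp]
        exact p.E.C.isStrict.assoc h _ _ _ (Cell.composable_eval hab p) (Cell.composable_eval hbc p)
      comp_one := fun h a => Cell.ext fun p => by
        simp only [Cell.eval_comp, Cell.eval_one, Cell.eval_s]
        exact p.E.C.isStrict.comp_one h _
      one_comp' := fun h a => Cell.ext fun p => by
        simp only [Cell.eval_comp, Cell.eval_one, Cell.eval_t]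
        exact p.E.C.isStrict.one_comp' h _
      interchange := fun q a b c d hab hcd hac hbd => Cell.ext fun p => by
        simp only [Cell.eval_comp]
        exact p.E.C.isStrict.interchange q _ _ _ _ (Cell.composable_eval hab p)
          (Cell.composable_eval hcd p) (Cell.composable_eval hac p) (Cell.composable_eval hbd p) }

/-- The free stretching satisfying `P` on a multiple set. -/
noncomputable abbrev free (P : ObjectProperty (Stretching.{u} m)) (X : MSet.{u}) :
    Stretching.{u} m where
  M := freeMagma P X true
  C := freeStrict P X
  π :=
    { map := fun _ => Cell.π
      map_s := fun h x => Cell.ext fun p => by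
        simp only [Cell.eval_π, Cell.eval_s]; exact p.E.π.map_s h _
      map_t := fun h x => Cell.ext fun p => by
        simp only [Cell.eval_π, Cell.eval_t]; exact p.E.π.map_t h _
      map_one := fun h x => Cell.ext fun p => by
        simp only [Cell.eval_π, Cell.eval_one]; exact p.E.π.map_one h _
      map_comp := fun h x y e => Cell.ext fun p => by
        simp only [Cell.eval_π, Cell.eval_comp]
        exact p.E.π.map_comp h _ _ (Cell.composable_eval e p)
      map_rev := fun h hm x => Cell.ext fun p => by
        simp only [Cell.eval_π, Cell.eval_rev]; exact p.E.π.map_rev h hm _ }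
  bracket := Cell.bracket
  s_bracket q x y e := Cell.ext fun p => by
    simp only [Cell.eval_s, Cell.eval_bracket]
    exact p.E.s_bracket q _ _ (Cell.parallel_eval e p)
  t_bracket q x y e := Cell.ext fun p => by
    simp only [Cell.eval_t, Cell.eval_bracket]
    exact p.E.t_bracket q _ _ (Cell.parallel_eval e p)
  s_bracket_self h x y e := Cell.ext fun p => by
    simp only [Cell.eval_s, Cell.eval_bracket]
    exact p.E.s_bracket_self h _ _ (Cell.parallel_eval e p)
  t_bracket_self h x y e := Cell.ext fun p => by
    simp only [Cell.eval_t, Cell.eval_bracket]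
    exact p.E.t_bracket_self h _ _ (Cell.parallel_eval e p)
  π_bracket h x y e := Cell.ext fun p => by
    simp only [Cell.eval_π, Cell.eval_one, Cell.eval_bracket]
    exact p.E.π_bracket h _ _ (Cell.parallel_eval e p)

/-- The inverse laws are equations, and every model here satisfies them by `p.prop`. -/
theorem hasInverses_free (X : MSet.{u}) : hasInverses m (free (hasInverses m) X) where
  comp_rev h hm a := Cell.ext fun p => by
    simp only [Cell.eval_comp, Cell.eval_rev, Cell.eval_one,
      Cell.eval_t]
    exact p.prop.comp_rev h hm _
  rev_comp h hm a := Cell.ext fun p => by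
    simp only [Cell.eval_comp, Cell.eval_rev, Cell.eval_one,
      Cell.eval_s]
    exact p.prop.rev_comp h hm _

/-- The inclusion of the generators in the free stretching. -/
def unit (P : ObjectProperty (Stretching.{u} m)) (X : MSet.{u}) :
    MSet.Hom X (free P X).M.toMSet where
  map _ x := Cell.mk (.var x) fun _ => trivial
  map_s h x := Cell.ext fun p => by
    simp only [Cell.eval_s]; exact p.f.map_s h x
  map_t h x := Cell.ext fun p => by
    simp only [Cell.eval_t]; exact p.f.map_t h x

/-! ### The universal property. -/

/-- Evaluation in a model preserves all the operations of the two magmas. -/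
noncomputable def Model.evalHom (p : Model P X) (σ : Bool) :
    ReflMagmaM.Hom (freeMagma P X σ) (p.E.magma σ) where
  map _ := Cell.eval p
  map_s := Cell.eval_s p
  map_t := Cell.eval_t p
  map_one := Cell.eval_one p
  map_comp := Cell.eval_comp p
  map_rev := Cell.eval_rev p

/-- The morphism from the free stretching to a model. -/
noncomputable def Model.desc (p : Model P X) : Hom (free P X) p.E where
  f := p.evalHom true
  c := p.evalHom false
  w _ x := (Cell.eval_π p x).symm
  map_bracket := Cell.eval_bracket p

/-- The two components of a morphism out of the free stretching. -/
def Hom.component {E : Stretching.{u} m} (a : Hom (free P X) E) :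
    (σ : Bool) → ReflMagmaM.Hom (freeMagma P X σ) (E.magma σ)
  | true => a.f
  | false => a.c

/-- Induction runs over both sorts at once. It applies because subterms of an everywhere-defined
term are everywhere defined. -/
theorem Hom.component_mk_eq {E : Stretching.{u} m} {a b : Hom (free P X) E}
    (hab : ∀ I (x : X.X I), a.f.map I ((unit P X).map I x) = b.f.map I ((unit P X).map I x))
    {σ : Bool} {I : Color} (x : Term m X σ I) (hx : ∀ p : Model P X, p.Defined x) :
    (a.component σ).map I (Cell.mk x hx) = (b.component σ).map I (Cell.mk x hx) := by
  induction x with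
  | var x => exact hab _ x
  | s h x ih =>
    -- The class of a compound term is the operation applied to the class of its subterm, despite
    -- the chosen representative: both have the same values.
    have e : Cell.mk (.s h x) hx = (freeMagma P X _).s h (Cell.mk x hx) :=
      Cell.ext fun p => (Cell.eval_s p h (Cell.mk x hx)).symm
    rw [e, MSet.Hom.map_s, MSet.Hom.map_s, ih hx]
  | t h x ih =>
    have e : Cell.mk (.t h x) hx = (freeMagma P X _).t h (Cell.mk x hx) :=
      Cell.ext fun p => (Cell.eval_t p h (Cell.mk x hx)).symm
    rw [e, MSet.Hom.map_t, MSet.Hom.map_t, ih hx]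
  | one h x ih =>
    have e : Cell.mk (.one h x) hx = (freeMagma P X _).one h (Cell.mk x hx) :=
      Cell.ext fun p => (Cell.eval_one p h (Cell.mk x hx)).symm
    rw [e, ReflMagmaM.Hom.map_one, ReflMagmaM.Hom.map_one, ih hx]
  | rev h hm x ih =>
    have e : Cell.mk (.rev h hm x) hx = (freeMagma P X _).rev h hm (Cell.mk x hx) :=
      Cell.ext fun p => (Cell.eval_rev p h hm (Cell.mk x hx)).symm
    rw [e, ReflMagmaM.Hom.map_rev, ReflMagmaM.Hom.map_rev, ih hx]
  | comp h x y ihx ihy =>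
    -- Definedness of the composite in every model yields composability in the quotient.
    have hxy : (freeMagma P X _).s h (Cell.mk x fun p => (hx p).1) =
        (freeMagma P X _).t h (Cell.mk y fun p => (hx p).2.1) :=
      Cell.ext fun p => by rw [Cell.eval_s, Cell.eval_t]; exact (hx p).2.2
    have e : Cell.mk (.comp h x y) hx = (freeMagma P X _).comp h _ _ hxy :=
      Cell.ext fun p => (dif_pos (hx p).2.2).trans (Cell.eval_comp p h _ _ hxy).symm
    rw [e]
    refine ((a.component _).map_comp h _ _ hxy).trans
      (Eq.trans ?_ ((b.component _).map_comp h _ _ hxy).symm)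
    simp only [ihx fun p => (hx p).1, ihy fun p => (hx p).2.1]
  | π x ih =>
    have e : Cell.mk (.π x) hx = (free P X).π.map _ (Cell.mk x hx) :=
      Cell.ext fun p => (Cell.eval_π p (Cell.mk x hx)).symm
    rw [e]
    -- There are no variables in `C`; the square `w` transfers agreement from the `M` side.
    exact (a.w _ _).symm.trans ((congrArg (E.π.map _) (ih hx)).trans (b.w _ _))
  | bracket h x y ihx ihy =>
    have hxy : (free P X).π.map _ (Cell.mk x fun p => (hx p).1) =
        (free P X).π.map _ (Cell.mk y fun p => (hx p).2.1) :=
      Cell.ext fun p => by rw [Cell.eval_π, Cell.eval_π]; exact (hx p).2.2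
    have e : Cell.mk (.bracket h x y) hx = (free P X).bracket h _ _ hxy :=
      Cell.ext fun p => (dif_pos (hx p).2.2).trans (Cell.eval_bracket p h _ _ hxy).symm
    have ex : a.f.map _ _ = b.f.map _ _ := ihx fun p => (hx p).1
    have ey : a.f.map _ _ = b.f.map _ _ := ihy fun p => (hx p).2.1
    rw [e]
    refine (a.map_bracket h _ _ hxy).trans (Eq.trans ?_ (b.map_bracket h _ _ hxy).symm)
    simp only [ex, ey]

theorem Hom.ext_free {E : Stretching.{u} m} {a b : Hom (free P X) E}
    (hab : ∀ I (x : X.X I), a.f.map I ((unit P X).map I x) = b.f.map I ((unit P X).map I x)) :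
    a = b := by
  have key (σ : Bool) (I : Color) (x : Cell P X σ I) :
      (a.component σ).map I x = (b.component σ).map I x := by
    rw [← x.mk_term]
    exact component_mk_eq hab _ _
  apply Hom.ext
  · apply ReflMagmaM.Hom.ext
    funext I x
    exact key true I x
  · apply ReflMagmaM.Hom.ext
    funext I x
    exact key false I x

/-- The universal property of the free stretching satisfying `P`. -/
noncomputable def freeEquiv (P : ObjectProperty (Stretching.{u} m)) (X : MSet.{u})
    (E : Stretching.{u} m) (hE : P E) : Hom (free P X) E ≃ MSet.Hom X E.M.toMSet where
  toFun a := (unit P X).comp a.f.toHom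
  invFun f := Model.desc ⟨E, hE, f⟩
  -- A variable evaluates to its image under `f`, so both morphisms agree on generators by
  -- definition.
  left_inv _ := Hom.ext_free fun _ _ => rfl
  right_inv _ := rfl

/-! ### The adjunctions and their monads. -/

/-- The free stretching is left adjoint to the forgetful functor. -/
noncomputable def forgetAdjunction (m : ℕ) :=
  Adjunction.adjunctionOfEquivLeft (G := forget.{u} m) (F_obj := free ⊤)
    (fun X E => freeEquiv ⊤ X E trivial) (fun _ _ _ _ _ => rfl)

/-- The free stretching with inverses is left adjoint to the restricted forgetful functor. -/
noncomputable def forgetInvAdjunction (m : ℕ) :=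
  Adjunction.adjunctionOfEquivLeft (G := forgetInv.{u} m)
    (F_obj := fun X => ⟨free (hasInverses m) X, hasInverses_free X⟩)
    -- The subcategory is full, so its morphisms are those of stretchings and the same universal
    -- property applies.
    (fun X E => (InducedCategory.homEquiv).trans (freeEquiv (hasInverses m) X E.obj E.property))
    (fun _ _ _ _ _ => rfl)

end Stretching

theorem mainTheorem2 (m : ℕ) :
    (∃ (F : MSet.{u} ⥤ Stretching.{u} m) (adj : F ⊣ Stretching.forget.{u} m)
      (T : CategoryTheory.Monad MSet.{u}), T = adj.toMonad) ∧
    (∃ (F : MSet.{u} ⥤ (Stretching.hasInverses.{u} m).FullSubcategory)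
      (adj : F ⊣ Stretching.forgetInv.{u} m) (T : CategoryTheory.Monad MSet.{u}), T = adj.toMonad) :=
  ⟨⟨_, Stretching.forgetAdjunction m, _, rfl⟩, ⟨_, Stretching.forgetInvAdjunction m, _, rfl⟩⟩
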